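/- Let $d\ge 1$, $\rho,\sigma>0$. Let $(X,Y)$ be a random pair with values in $\mathbb R^d\times\mathbb R$, $\mathbb E[Y^2]<\infty$, let $\mu$ be the law of $X$, $S$ its support, and $r$ a version of the regression function, $r(X)=\mathbb E[Y\mid X]$ almost surely. Assume that (i) $S$ is bounded with diameter $D>0$ and $\mu(\{y:\|y-x\|\le\varepsilon\})\ge\rho\varepsilon^d$ for all $x\in S$ and $\varepsilon\in(0,D]$ (Euclidean norm); (ii) $\operatorname{Var}(Y-r(X)\mid X)\le\sigma^2$ almost surely; (iii) $r$ is $1$-Lipschitz on $S$. Let $(X_1,Y_1),\dots,(X_n,Y_n)$ be i.i.d. copies of $(X,Y)$, and let $U_1,\dots,U_n$ be i.i.d. uniform on $[0,1]$ and independent of them. The $1$-nearest neighbor estimate at $x$ built on a finite sample is the value $Y_i$ for the sample point minimizing $\|X_i-x\|$, distance ties being broken by the smallest $U_i$. The $k$-bagged $1$-nearest neighbor estimate (with replacement) built on a sample of size $N$ is the average, over all $N^k$ equally likely ways of drawing $k$ observations with replacement, of the $1$-nearest neighbor estimate of the resample; almost surely it equals $\sum_{i=1}^N v_iY_{(i)}(x)$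 with $v_i=(1-\frac{i-1}N)^k-(1-\frac iN)^k$, where $Y_{(i)}(x)$ is the response of the $i$-th nearest neighbor of $x$. The median of $r_1,\dots,r_m$ is the order statistic $r_{(\lceil m/2\rceil)}$. Let $$c=\min\Big\{\rho\Big(\frac{\sigma}{4e\sqrt2}\Big)^d,\ \frac{32e^2}{\sigma^2\rho^{2/d}},\ 1\Big\},\qquad \delta\in[e^{-cn+1},1),\qquad m=\lceil\ln(1/\delta)\rceil,\qquad N=\lfloor n/m\rfloor,$$ $$k^\star=\left\lfloor\left(\frac{32e^2n}{\rho^{2/d}\sigma^2m}\right)^{\frac d{d+2}}\right\rfloor .$$ Then $1\le m\le cn$ and $1\le k^\star\le N$. Moreover, for every choice of $m$ disjoint blocks of $N$ observations each, let $\hat r_n^{\mathsf{mom}}(x)$ be the median of the $m$ estimates at $x$ obtained by applying the $k^\star$-bagged $1$-nearest neighbor estimate to each block. Then, for every $x\in S$, $$\mathbb P\left(\big|\hat r_n^{\mathsf{mom}}(x)-r(x)\big|\ge128e^3\left(\frac{\sigma^2\lceil\ln(1/\delta)\rceil}{\rho n}\right)^{\frac1{d+2}}\right)\le\delta .$$ 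-/

import Mathlib

open MeasureTheory ProbabilityTheory

noncomputable section

namespace MoMReg

/-- `ℝ^d` with the Euclidean norm. -/
abbrev Space (d : ℕ) : Type := EuclideanSpace ℝ (Fin d)

/-- An observation `((X, Y), U)`: the pair `(X, Y)`, together with the auxiliary variable `U`
used to break distance ties. -/
abbrev Obs (d : ℕ) : Type := (Space d × ℝ) × ℝ

/-- `r` is a version of the regression function `x ↦ E[Y | X = x]` of a square integrable pair
`(X, Y)` of law `ν`. -/
def IsRegressionFunction {d : ℕ} (ν : Measure (Space d × ℝ)) (r : Space d → ℝ) : Prop :=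
  ν[(fun p => p.2) | MeasurableSpace.comap Prod.fst inferInstance] =ᵐ[ν] fun p => r p.1

/-- The law `ν` of `(X, Y)`, with regression function `r`, belongs to the class `𝓕_{ρ,σ}`.
Here `ν.fst` is the law `μ` of `X` and `ν.fst.support` is the support `S` of `μ`. -/
structure InClass {d : ℕ} (ρ σ : ℝ) (ν : Measure (Space d × ℝ)) (r : Space d → ℝ) : Prop where
  /-- `E[Y²] < ∞` -/
  memLp : MemLp (fun p : Space d × ℝ => p.2) 2 ν
  regression : IsRegressionFunction ν r
  bounded : Bornology.IsBounded ν.fst.support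
  diam_pos : 0 < Metric.diam ν.fst.support
  /-- `μ(B(x, ε)) ≥ ρ ε^d` for all `x ∈ S` and `ε ∈ (0, D]` -/
  ball : ∀ x ∈ ν.fst.support, ∀ ε ∈ Set.Ioc 0 (Metric.diam ν.fst.support),
    ρ * ε ^ d ≤ ν.fst.real (Metric.closedBall x ε)
  /-- `Var(Y - r(X) | X) ≤ σ²` -/
  noise : Var[fun p : Space d × ℝ => p.2 - r p.1; ν | MeasurableSpace.comap Prod.fst inferInstance]
    ≤ᵐ[ν] fun _ => σ ^ 2
  lipschitz : LipschitzOnWith 1 r ν.fst.support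

/-- `Z₁, …, Zₙ` are i.i.d., `Zᵢ = ((Xᵢ, Yᵢ), Uᵢ)` with `(Xᵢ, Yᵢ)` of law `ν` and `Uᵢ`
uniform on `[0, 1]` and independent of `(Xᵢ, Yᵢ)`. -/
structure IsSample {d n : ℕ} (ν : Measure (Space d × ℝ)) {Ω : Type*} [MeasurableSpace Ω]
    (P : Measure Ω) (Z : Fin n → Ω → Obs d) : Prop where
  law : ∀ i, HasLaw (Z i) (ν.prod (volume.restrict (Set.Icc (0 : ℝ) 1))) P
  indep : iIndepFun Z P

/-- The permutation that lists the indices of the observations `z` by increasing distance to `x`,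
distance ties being broken by sorting the auxiliary variables: `nnOrder z x i` is the index of
the `i`-th nearest neighbor of `x` (counting from `0`). -/
def nnOrder {d N : ℕ} (z : Fin N → Obs d) (x : Space d) : Equiv.Perm (Fin N) :=
  Tuple.sort fun i => toLex (‖(z i).1.1 - x‖, (z i).2)

/-- `Y_{(i)}(x)`, counting from `i = 0`. -/
def nnValue {d N : ℕ} (z : Fin N → Obs d) (x : Space d) (i : Fin N) : ℝ :=
  (z (nnOrder z x i)).1.2

/-- The `1`-nearest neighbor estimate at `x` built on the sample `z` (and `0` if it is empty). -/
def oneNN {d k : ℕ} (z : Fin k → Obs d) (x : Space d) : ℝ :=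
  if h : 0 < k then nnValue z x ⟨0, h⟩ else 0

/-- The `k`-bagged `1`-nearest neighbor estimate (with replacement) at `x` built on the sample `z`
of size `N`: the average, over the `N^k` equally likely ways to draw `k` observations
from `z` with replacement, of the `1`-nearest neighbor estimate of the resample. -/
def bagged {d N : ℕ} (k : ℕ) (z : Fin N → Obs d) (x : Space d) : ℝ :=
  ((N : ℝ) ^ k)⁻¹ * ∑ I : Fin k → Fin N, oneNN (fun l => z (I l)) x

/-- When the sorting keys `(‖Xᵢ - x‖, Uᵢ)` are pairwise distinct (which is almost surely the case),
the bagged estimate is the weighted nearest neighbors estimate with weights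
`v_i = (1 - (i-1)/N)^k - (1 - i/N)^k`, `1 ≤ i ≤ N`. -/
theorem bagged_eq_weighted {d N k : ℕ} (hk : 0 < k) (z : Fin N → Obs d) (x : Space d)
    (hz : Function.Injective fun i => toLex (‖(z i).1.1 - x‖, (z i).2)) :
    bagged k z x = ∑ i : Fin N,
      ((1 - (i : ℝ) / N) ^ k - (1 - ((i : ℝ) + 1) / N) ^ k) * nnValue z x i := by
  rcases Nat.eq_zero_or_pos N with rfl | hN
  · have : IsEmpty (Fin k → Fin 0) := ⟨fun f => (f ⟨0, hk⟩).elim0⟩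
    simp [bagged]
  have hN0 : (N : ℝ) ≠ 0 := by positivity
  have hne : (Finset.univ : Finset (Fin k)).Nonempty := ⟨⟨0, hk⟩, Finset.mem_univ _⟩
  set key : Fin N → ℝ ×ₗ ℝ := fun i => toLex (‖(z i).1.1 - x‖, (z i).2) with hkey
  have hmono : StrictMono (key ∘ nnOrder z x) :=
    (Tuple.monotone_sort key).strictMono_of_injective (hz.comp (nnOrder z x).injective)
  have h1 : ∀ J : Fin k → Fin N, oneNN (fun l => z (nnOrder z x (J l))) x
      = nnValue z x (Finset.univ.inf' hne J) := by
    intro J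
    set w : Fin k → Obs d := fun l => z (nnOrder z x (J l)) with hw
    have hs := Tuple.monotone_sort fun l => toLex (‖(w l).1.1 - x‖, (w l).2)
    set s0 := nnOrder w x ⟨0, hk⟩ with hs0
    have hmin : ∀ l, J s0 ≤ J l := by
      intro l
      obtain ⟨l', rfl⟩ := (nnOrder w x).surjective l
      exact hmono.le_iff_le.1 (hs (show (⟨0, hk⟩ : Fin k) ≤ l' from Nat.zero_le _))
    have : Finset.univ.inf' hne J = J s0 :=
      le_antisymm (Finset.inf'_le _ (Finset.mem_univ _)) (Finset.le_inf' _ _ fun l _ => hmin l)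
    rw [this, oneNN, dif_pos hk]
    rfl
  have h2 : ∑ I : Fin k → Fin N, oneNN (fun l => z (I l)) x
      = ∑ J : Fin k → Fin N, nnValue z x (Finset.univ.inf' hne J) := by
    rw [← Equiv.sum_comp (
      Equiv.arrowCongr (Equiv.refl (Fin k)) (nnOrder z x))]
    exact Finset.sum_congr rfl fun J _ => h1 J
  have h3 : ∀ i : Fin N, ((Finset.univ.filter fun J : Fin k → Fin N =>
      Finset.univ.inf' hne J = i).card : ℝ) = ((N : ℝ) - i) ^ k - ((N : ℝ) - (i + 1)) ^ k := by
    intro i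
    have hsub : (Fintype.piFinset fun _ : Fin k => Finset.Ioi i) ⊆
        Fintype.piFinset fun _ : Fin k => Finset.Ici i :=
      Fintype.piFinset_subset _ _ fun _ => Finset.Ioi_subset_Ici_self
    have heq : (Finset.univ.filter fun J : Fin k → Fin N => Finset.univ.inf' hne J = i)
        = (Fintype.piFinset fun _ : Fin k => Finset.Ici i) \
          Fintype.piFinset fun _ : Fin k => Finset.Ioi i := by
      ext J
      have e1 : i ≤ Finset.univ.inf' hne J ↔ ∀ l, i ≤ J l := by simp
      have e2 : i < Finset.univ.inf' hne J ↔ ∀ l, i < J l := by simp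
      simp only [Finset.mem_filter, Finset.mem_univ, true_and, Finset.mem_sdiff,
        Fintype.mem_piFinset, Finset.mem_Ici, Finset.mem_Ioi, ← e1, ← e2, not_lt]
      exact ⟨fun h => ⟨h.ge, h.le⟩, fun h => le_antisymm h.2 h.1⟩
    rw [heq, Finset.cast_card_sdiff hsub]
    simp only [Fintype.card_piFinset, Finset.prod_const, Finset.card_univ, Fintype.card_fin,
      Fin.card_Ici, Fin.card_Ioi, Nat.cast_pow]
    rw [Nat.cast_sub i.2.le, Nat.sub_sub, Nat.cast_sub (by omega)]
    push_cast
    ring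
  rw [bagged, h2, ← Finset.sum_fiberwise Finset.univ (fun J => Finset.univ.inf' hne J),
    Finset.mul_sum]
  refine Finset.sum_congr rfl fun i _ => ?_
  rw [Finset.sum_congr rfl fun J hJ => by rw [(Finset.mem_filter.1 hJ).2], Finset.sum_const,
    nsmul_eq_mul, h3 i, one_sub_div hN0, one_sub_div hN0, div_pow, div_pow]
  field_simp

/-- The median `r_{(⌈m/2⌉)}` of `r₁, …, r_m`, where `r_{(1)} ≤ … ≤ r_{(m)}` is the sorted list
(position `⌈m/2⌉`, counted from `1`, is position `(m - 1) / 2` counted from `0`). -/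
def median {m : ℕ} (v : Fin m → ℝ) : ℝ :=
  if h : 0 < m then v (Tuple.sort v ⟨(m - 1) / 2, by omega⟩) else 0

/-- The median-of-means estimate at `x` with `m` disjoint blocks of length `N`, `block (j, i)`
being the index of the `i`-th observation of the `j`-th block, and with `k`-bagged
`1`-nearest neighbor base estimates. -/
def momBagged {d n m N : ℕ} (k : ℕ) (block : Fin m × Fin N ↪ Fin n) (z : Fin n → Obs d)
    (x : Space d) : ℝ :=
  median fun j => bagged k (fun i => z (block (j, i))) x

/-- The constant `c = ρ (σ / (4e√2))^d ∧ 32e² / (σ² ρ^{2/d}) ∧ 1`. -/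
def cConst (d : ℕ) (ρ σ : ℝ) : ℝ :=
  min (min (ρ * (σ / (4 * Real.exp 1 * √2)) ^ d)
    (32 * Real.exp 1 ^ 2 / (σ ^ 2 * ρ ^ (2 / (d : ℝ))))) 1

/-- The number of blocks `m = ⌈ln(1/δ)⌉`. -/
def numBlocks (δ : ℝ) : ℕ := ⌈Real.log (1 / δ)⌉₊

/-- The resample size `k⋆ = ⌊(32e²n / (ρ^{2/d} σ² m))^{d/(d+2)}⌋`. -/
def kStar (d : ℕ) (ρ σ : ℝ) (n m : ℕ) : ℕ :=
  ⌊(32 * Real.exp 1 ^ 2 * n / (ρ ^ (2 / (d : ℝ)) * σ ^ 2 * m)) ^ ((d : ℝ) / (d + 2))⌋₊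

end MoMReg

end

noncomputable section

namespace MoMReg

/-! Write the bagged estimate as `∑ i, wᵢ Yᵢ`, where `wᵢ` is the fraction of the `N ^ k` resamples
in which observation `i` is selected as nearest to `x`. Counting resamples directly makes ties
harmless: the keys need not be distinct. The weights do not involve the responses, so the error
splits into a noise sum and a bias sum.

Noise: given covariates and tie-breakers, the noise variables are centered, uncorrelated, of
variance at most `σ²`. As `wᵢ ≤ k / N` and `∑ wᵢ = 1`, the second moment is at most `σ² k / N`
(`integral_sq_sum_baggedWeight_le`).

Bias: by the Lipschitz property it is at most the average over resamples of the distance from `x` to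
its nearest neighbor. The fraction of resamples lying entirely outside the ball of radius `t` is the
`k`-th power of the fraction of observations outside it. The ball condition makes its mean
exponentially small in `t / s` once `k ρ s ^ d ≥ 1 / 2`, and integrating over `t` gives `8 s`.

Markov's inequality on both parts (`InClass.measure_bagged_le`), with `k⋆` balancing them, makes
each block fail with probability at most `1 / (4e²)`. If the median fails, so do at least half of
the blocks; a union bound over at most `2 ^ m` sets of blocks gives `2 ^ m (4e²) ^ (-m/2) = e ^ (-m)
≤ δ`. -/

/-! ### Weights of the bagged estimate -/

/-- The index of the resampled observation whose response is the `1`-nearest neighbor estimate. -/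
def nearestIndex {d N k : ℕ} (hk : 0 < k) (z : Fin N → Obs d) (x : Space d) (I : Fin k → Fin N) :
    Fin N :=
  I (nnOrder (fun l => z (I l)) x ⟨0, hk⟩)

/-- The weight of the `i`-th observation in the bagged estimate. -/
def baggedWeight {d N k : ℕ} (hk : 0 < k) (z : Fin N → Obs d) (x : Space d) (i : Fin N) : ℝ :=
  ((N : ℝ) ^ k)⁻¹ * ∑ I : Fin k → Fin N, if nearestIndex hk z x I = i then 1 else 0

theorem sum_baggedWeight_mul {d N k : ℕ} (hk : 0 < k) (z : Fin N → Obs d) (x : Space d)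
    (f : Fin N → ℝ) :
    ∑ i, baggedWeight hk z x i * f i
      = ((N : ℝ) ^ k)⁻¹ * ∑ I : Fin k → Fin N, f (nearestIndex hk z x I) := by
  simp only [baggedWeight, mul_assoc, ← Finset.mul_sum, Finset.sum_mul]
  rw [Finset.sum_comm]
  simp

theorem bagged_eq_sum_baggedWeight {d N k : ℕ} (hk : 0 < k) (z : Fin N → Obs d) (x : Space d) :
    bagged k z x = ∑ i, baggedWeight hk z x i * (z i).1.2 := by
  rw [sum_baggedWeight_mul, bagged]
  simp [oneNN, hk, nnValue, nearestIndex]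

theorem baggedWeight_nonneg {d N k : ℕ} (hk : 0 < k) (z : Fin N → Obs d) (x : Space d)
    (i : Fin N) : 0 ≤ baggedWeight hk z x i := by
  unfold baggedWeight
  positivity

theorem sum_baggedWeight {d N k : ℕ} (hk : 0 < k) (hN : 0 < N) (z : Fin N → Obs d)
    (x : Space d) : ∑ i, baggedWeight hk z x i = 1 := by
  have h := sum_baggedWeight_mul hk z x fun _ => 1
  have : (N : ℝ) ^ k ≠ 0 := by positivity
  simpa [this] using h

theorem baggedWeight_le_one {d N k : ℕ} (hk : 0 < k) (hN : 0 < N) (z : Fin N → Obs d)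
    (x : Space d) (i : Fin N) : baggedWeight hk z x i ≤ 1 := by
  rw [← sum_baggedWeight hk hN z x]
  exact Finset.single_le_sum (fun j _ => baggedWeight_nonneg hk z x j) (Finset.mem_univ i)

/-- Each observation enters the resample with probability at most `k / N`. -/
theorem baggedWeight_le {d N k : ℕ} (hk : 0 < k) (hN : 0 < N) (z : Fin N → Obs d)
    (x : Space d) (i : Fin N) : baggedWeight hk z x i ≤ (k : ℝ) / N := by
  have hcard : ∀ l : Fin k, ∑ I : Fin k → Fin N, (if I l = i then (1 : ℝ) else 0)
      = (N : ℝ) ^ (k - 1) := by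
    intro l
    have h := Fintype.card_filter_piFinset_const_eq_of_mem (Finset.univ : Finset (Fin N)) l
      (Finset.mem_univ i)
    simp only [Finset.card_univ, Fintype.card_fin, Fintype.piFinset_univ] at h
    rw [Finset.sum_boole, h, Nat.cast_pow]
  have hle : ∑ I : Fin k → Fin N, (if nearestIndex hk z x I = i then (1 : ℝ) else 0)
      ≤ k * (N : ℝ) ^ (k - 1) := by
    -- Union bound: the selected index is one of the `k` draws.
    calc _ ≤ ∑ I : Fin k → Fin N, ∑ l : Fin k, (if I l = i then (1 : ℝ) else 0) := by
          refine Finset.sum_le_sum fun I _ => ?_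
          exact Finset.single_le_sum (f := fun l => if I l = i then (1 : ℝ) else 0)
            (fun l _ => by positivity) (Finset.mem_univ _)
      _ = _ := by
          rw [Finset.sum_comm]
          simp [hcard]
  have hN' : (0 : ℝ) < N := by exact_mod_cast hN
  rw [baggedWeight, inv_mul_le_iff₀ (by positivity)]
  refine hle.trans_eq ?_
  obtain ⟨k, rfl⟩ := Nat.exists_eq_succ_of_ne_zero hk.ne'
  simp only [Nat.succ_eq_add_one, Nat.add_sub_cancel, pow_succ]
  field_simp

theorem sum_baggedWeight_sq_le {d N k : ℕ} (hk : 0 < k) (hN : 0 < N) (z : Fin N → Obs d)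
    (x : Space d) : ∑ i, baggedWeight hk z x i ^ 2 ≤ (k : ℝ) / N := by
  calc ∑ i, baggedWeight hk z x i ^ 2 ≤ ∑ i, ((k : ℝ) / N) * baggedWeight hk z x i := by
        refine Finset.sum_le_sum fun i _ => ?_
        rw [sq]
        exact mul_le_mul_of_nonneg_right (baggedWeight_le hk hN z x i)
          (baggedWeight_nonneg hk z x i)
    _ = _ := by rw [← Finset.mul_sum, sum_baggedWeight hk hN, mul_one]

theorem nearestIndex_congr {d N k : ℕ} (hk : 0 < k) {z z' : Fin N → Obs d} (x : Space d)
    (h : ∀ i, (z i).1.1 = (z' i).1.1 ∧ (z i).2 = (z' i).2) :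
    nearestIndex hk z x = nearestIndex hk z' x := by
  ext1 I
  simp only [nearestIndex, nnOrder, h]

/-- The weights depend on the covariates and the tie-breaking variables only. -/
theorem baggedWeight_congr {d N k : ℕ} (hk : 0 < k) {z z' : Fin N → Obs d} (x : Space d)
    (h : ∀ i, (z i).1.1 = (z' i).1.1 ∧ (z i).2 = (z' i).2) :
    baggedWeight hk z x = baggedWeight hk z' x := by
  ext1 i
  simp only [baggedWeight, nearestIndex_congr hk x h]

/-- A lexicographic minimum also minimizes the first key, the distance. This turns the tail of the
nearest distance into an event that factorizes over the draws. -/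
theorem lt_norm_nearestIndex_iff {d N k : ℕ} (hk : 0 < k) (z : Fin N → Obs d) (x : Space d)
    (I : Fin k → Fin N) (t : ℝ) :
    t < ‖(z (nearestIndex hk z x I)).1.1 - x‖ ↔ ∀ l, t < ‖(z (I l)).1.1 - x‖ := by
  refine ⟨fun h l => h.trans_le ?_, fun h => h _⟩
  have hs := Tuple.monotone_sort fun l => toLex (‖(z (I l)).1.1 - x‖, (z (I l)).2)
  obtain ⟨l', rfl⟩ := (nnOrder (fun l => z (I l)) x).surjective l
  have h := hs (show (⟨0, hk⟩ : Fin k) ≤ l' from Nat.zero_le _)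
  rcases Prod.Lex.toLex_le_toLex.1 h with h | h
  exacts [h.le, h.1.le]

/-! ### Measurability -/

/-- A sorting permutation is characterized by finitely many comparisons of keys, equal keys being
listed by increasing index. -/
theorem measurableSet_nnOrder_eq {d N : ℕ} (x : Space d) (τ : Equiv.Perm (Fin N)) :
    MeasurableSet {z : Fin N → Obs d | nnOrder z x = τ} := by
  have hn : ∀ i : Fin N, Measurable fun z : Fin N → Obs d => ‖(z i).1.1 - x‖ := fun i => by
    fun_prop
  have hu : ∀ i : Fin N, Measurable fun z : Fin N → Obs d => (z i).2 := fun i => by fun_prop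
  have : {z : Fin N → Obs d | nnOrder z x = τ} = {z |
      (∀ i j, i ≤ j → (‖(z (τ i)).1.1 - x‖ < ‖(z (τ j)).1.1 - x‖ ∨
        ‖(z (τ i)).1.1 - x‖ = ‖(z (τ j)).1.1 - x‖ ∧ (z (τ i)).2 ≤ (z (τ j)).2)) ∧
      ∀ i j, i < j → (‖(z (τ i)).1.1 - x‖ = ‖(z (τ j)).1.1 - x‖ ∧ (z (τ i)).2 = (z (τ j)).2) →
        τ i < τ j} := by
    ext z
    simp only [Set.mem_ofPred_eq, nnOrder]
    rw [eq_comm, Tuple.eq_sort_iff]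
    simp only [Monotone, Function.comp_apply, Prod.Lex.toLex_le_toLex, toLex_inj, Prod.mk.injEq]
  rw [this]
  have hn' : ∀ i j : Fin N, Measurable fun z : Fin N → Obs d =>
      ‖(z i).1.1 - x‖ = ‖(z j).1.1 - x‖ := fun i j =>
    measurableSet_setOfPred.1 (measurableSet_eq_fun (hn i) (hn j))
  refine measurableSet_setOfPred.2 (.and ?_ ?_)
  · refine Measurable.forall fun i => .forall fun j => .imp measurable_const (.or ?_ (.and ?_ ?_))
    · exact measurableSet_setOfPred.1 (measurableSet_lt (hn _) (hn _))
    · exact hn' _ _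
    · exact measurableSet_setOfPred.1 (measurableSet_le (hu _) (hu _))
  · refine Measurable.forall fun i => .forall fun j =>
      .imp measurable_const (.imp (.and ?_ ?_) measurable_const)
    · exact hn' _ _
    · exact measurableSet_setOfPred.1 (measurableSet_eq_fun (hu _) (hu _))

theorem measurable_nearestIndex {d N k : ℕ} (hk : 0 < k) (x : Space d) (I : Fin k → Fin N) :
    Measurable fun z : Fin N → Obs d => nearestIndex hk z x I := by
  refine measurable_to_countable' fun i => ?_
  have : (fun z : Fin N → Obs d => nearestIndex hk z x I) ⁻¹' {i} =
      ⋃ τ : {τ : Equiv.Perm (Fin k) // I (τ ⟨0, hk⟩) = i},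
        (fun z l => z (I l)) ⁻¹' {w : Fin k → Obs d | nnOrder w x = τ} := by
    ext z
    simp [nearestIndex]
  rw [this]
  exact .iUnion fun τ => measurableSet_nnOrder_eq x τ.1 |>.preimage
    (measurable_pi_lambda _ fun l => measurable_pi_apply (I l))

theorem measurable_baggedWeight {d N k : ℕ} (hk : 0 < k) (x : Space d) (i : Fin N) :
    Measurable fun z : Fin N → Obs d => baggedWeight hk z x i := by
  refine (Finset.measurable_sum _ fun I _ => ?_).const_mul _
  exact Measurable.ite (measurable_nearestIndex hk x I (measurableSet_singleton i))
    measurable_const measurable_const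

theorem measurable_bagged {d N k : ℕ} (hk : 0 < k) (x : Space d) :
    Measurable fun z : Fin N → Obs d => bagged k z x := by
  simp only [bagged_eq_sum_baggedWeight hk]
  exact Finset.measurable_sum _ fun i _ => (measurable_baggedWeight hk x i).mul (by fun_prop)

/-! ### Median -/

/-- If the median is at distance at least `ε` from `c`, then so are at least half of the values. -/
theorem exists_finset_of_le_abs_median_sub {m : ℕ} (hm : 0 < m) (v : Fin m → ℝ) {ε c : ℝ}
    (h : ε ≤ |median v - c|) :
    ∃ J : Finset (Fin m), m ≤ 2 * J.card ∧ ∀ j ∈ J, ε ≤ |v j - c| := by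
  have hs : Monotone fun i => v (Tuple.sort v i) := Tuple.monotone_sort v
  -- The positions from `p` on, and those up to `p`, each make up at least half of all positions,
  -- whatever the parity of `m`.
  set p : Fin m := ⟨(m - 1) / 2, by omega⟩ with hp
  rw [median, dif_pos hm] at h
  rcases le_abs.1 h with h | h
  · refine ⟨(Finset.Ici p).map (Tuple.sort v).toEmbedding, ?_, ?_⟩
    · simp only [Finset.card_map, Fin.card_Ici, hp]
      omega
    · simp only [Finset.mem_map, Finset.mem_Ici, Equiv.coe_toEmbedding, forall_exists_index, and_imp]
      rintro _ i hi rfl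
      exact (h.trans (sub_le_sub_right (hs hi) c)).trans (le_abs_self _)
  · refine ⟨(Finset.Iic p).map (Tuple.sort v).toEmbedding, ?_, ?_⟩
    · simp only [Finset.card_map, Fin.card_Iic, hp]
      omega
    · simp only [Finset.mem_map, Finset.mem_Iic, Equiv.coe_toEmbedding, forall_exists_index, and_imp]
      rintro _ i hi rfl
      exact (h.trans (neg_le_neg (sub_le_sub_right (hs hi) c))).trans (neg_le_abs _)

/-! ### Product measures -/

/-- Resampling one coordinate preserves a product measure. -/
theorem measurePreserving_update {ι α : Type*} [Fintype ι] [DecidableEq ι] [MeasurableSpace α]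
    (Q : Measure α) [IsProbabilityMeasure Q] (i : ι) :
    MeasurePreserving (fun p : (ι → α) × α => Function.update p.1 i p.2)
      ((Measure.pi fun _ => Q).prod Q) (Measure.pi fun _ => Q) := by
  refine ⟨measurable_update', (Measure.pi_eq fun s hs => ?_).symm⟩
  rw [Measure.map_apply measurable_update' (.univ_pi hs)]
  have : (fun p : (ι → α) × α => Function.update p.1 i p.2) ⁻¹' Set.univ.pi s
      = (Set.univ.pi (Function.update s i Set.univ)) ×ˢ s i := by
    ext p
    simp only [Set.mem_preimage, Set.mem_univ_pi, Set.mem_prod]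
    constructor
    · refine fun h => ⟨fun j => ?_, by simpa using h i⟩
      by_cases hj : j = i
      · subst hj; simp
      · simpa [hj] using h j
    · rintro ⟨h1, h2⟩ j
      by_cases hj : j = i
      · subst hj; simpa using h2
      · simpa [hj] using h1 j
  rw [this, Measure.prod_prod, Measure.pi_pi, ← Finset.prod_erase_mul _ _ (Finset.mem_univ i),
    ← Finset.prod_erase_mul Finset.univ (fun j => Q (s j)) (Finset.mem_univ i)]
  simp only [Function.update_self, measure_univ, mul_one]
  congr 1
  exact Finset.prod_congr rfl fun j hj => by simp [Finset.ne_of_mem_erase hj]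

/-- Fubini in a single coordinate: replace it by an independent copy, then integrate the copy first.
-/
theorem integral_pi_eq_integral_update {ι α : Type*} [Fintype ι] [DecidableEq ι]
    [MeasurableSpace α] (Q : Measure α) [IsProbabilityMeasure Q] (i : ι) {g : (ι → α) → ℝ}
    (hg : Integrable g (Measure.pi fun _ => Q)) :
    Integrable (fun z => ∫ a, g (Function.update z i a) ∂Q) (Measure.pi fun _ => Q) ∧
    ∫ z, g z ∂(Measure.pi fun _ => Q)
      = ∫ z, ∫ a, g (Function.update z i a) ∂Q ∂(Measure.pi fun _ => Q) := by
  have h := measurePreserving_update Q i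
  have hint := h.integrable_comp_of_integrable hg
  refine ⟨hint.integral_prod_left, ?_⟩
  rw [← h.map_eq, integral_map h.measurable.aemeasurable
    (by rw [h.map_eq]; exact hg.aestronglyMeasurable), h.map_eq]
  exact integral_prod _ hint

theorem integral_pi_mono_of_update {ι α : Type*} [Fintype ι] [DecidableEq ι]
    [MeasurableSpace α] (Q : Measure α) [IsProbabilityMeasure Q] (i : ι) {g g' : (ι → α) → ℝ}
    (hg : Integrable g (Measure.pi fun _ => Q)) (hg' : Integrable g' (Measure.pi fun _ => Q))
    (h : ∀ z, ∫ a, g (Function.update z i a) ∂Q ≤ ∫ a, g' (Function.update z i a) ∂Q) :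
    ∫ z, g z ∂(Measure.pi fun _ => Q) ≤ ∫ z, g' z ∂(Measure.pi fun _ => Q) := by
  obtain ⟨h1, e1⟩ := integral_pi_eq_integral_update Q i hg
  obtain ⟨h2, e2⟩ := integral_pi_eq_integral_update Q i hg'
  rw [e1, e2]
  exact integral_mono h1 h2 h

/-- A product measure on blocks of blocks, seen as a product measure on all entries. -/
theorem map_uncurry_pi_pi {ι κ α : Type*} [Fintype ι] [Fintype κ] [MeasurableSpace α]
    (Q : Measure α) [IsProbabilityMeasure Q] :
    (Measure.pi fun _ : ι => Measure.pi fun _ : κ => Q).map (fun z p => z p.1 p.2)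
      = Measure.pi fun _ : ι × κ => Q := by
  refine (Measure.pi_eq fun s hs => ?_).symm
  rw [Measure.map_apply (by fun_prop) (.univ_pi hs)]
  have : (fun (z : ι → κ → α) (p : ι × κ) => z p.1 p.2) ⁻¹' Set.univ.pi s
      = Set.univ.pi fun i => Set.univ.pi fun j => s (i, j) := by
    ext z
    simp
  rw [this, Measure.pi_pi, Fintype.prod_prod_type]
  exact Finset.prod_congr rfl fun i _ => Measure.pi_pi _ _

/-! ### Noise -/

section Obs

variable {d : ℕ} (ν : Measure (Space d × ℝ)) [IsProbabilityMeasure ν]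
  (τ : Measure ℝ) [IsProbabilityMeasure τ]

/-- Integrating out the response of one observation. -/
theorem integral_mul_eq_integral_condExp_mul {ξ : Space d × ℝ → ℝ} (hξ : Integrable ξ ν)
    {H : Space d × ℝ → ℝ} (hH : Measurable H) {C : ℝ} (hC : ∀ p, |H p| ≤ C) :
    ∫ a : Obs d, H (a.1.1, a.2) * ξ a.1 ∂(ν.prod τ) = ∫ u, ∫ p : Space d × ℝ, H (p.1, u) *
      (ν[ξ | MeasurableSpace.comap Prod.fst inferInstance]) p ∂ν ∂τ := by
  have hm : MeasurableSpace.comap Prod.fst inferInstance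
      ≤ (inferInstance : MeasurableSpace (Space d × ℝ)) := measurable_fst.comap_le
  have hint : Integrable (fun a : Obs d => H (a.1.1, a.2) * ξ a.1) (ν.prod τ) :=
    (hξ.comp_fst τ).bdd_mul (c := C) (hH.comp (by fun_prop)).aestronglyMeasurable
      (.of_forall fun a => hC _)
  rw [integral_prod_symm _ hint]
  congr 1 with u
  have hHu : Measurable fun x : Space d => H (x, u) := hH.comp (by fun_prop)
  have hHs : StronglyMeasurable[MeasurableSpace.comap Prod.fst inferInstance]
      fun p : Space d × ℝ => H (p.1, u) :=
    (hHu.comp (comap_measurable (Prod.fst : Space d × ℝ → Space d))).stronglyMeasurable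
  rw [← integral_condExp hm]
  refine integral_congr_ae (condExp_mul_of_stronglyMeasurable_left hHs ?_ hξ)
  exact hξ.bdd_mul (c := C) (hHs.mono hm).aestronglyMeasurable (.of_forall fun p => hC _)

theorem integral_mul_eq_zero_of_condExp_eq_zero {ξ : Space d × ℝ → ℝ} (hξ : Integrable ξ ν)
    (h0 : ν[ξ | MeasurableSpace.comap Prod.fst inferInstance] =ᵐ[ν] 0)
    {H : Space d × ℝ → ℝ} (hH : Measurable H) {C : ℝ} (hC : ∀ p, |H p| ≤ C) :
    ∫ a : Obs d, H (a.1.1, a.2) * ξ a.1 ∂(ν.prod τ) = 0 := by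
  rw [integral_mul_eq_integral_condExp_mul ν τ hξ hH hC]
  refine integral_eq_zero_of_ae (.of_forall fun u => integral_eq_zero_of_ae ?_)
  filter_upwards [h0] with p hp
  simp [hp]

theorem integral_mul_le_of_condExp_le {ξ : Space d × ℝ → ℝ} (hξ : Integrable ξ ν) {c : ℝ}
    (hc : ν[ξ | MeasurableSpace.comap Prod.fst inferInstance] ≤ᵐ[ν] fun _ => c)
    {H : Space d × ℝ → ℝ} (hH : Measurable H) (hH0 : ∀ p, 0 ≤ H p) {C : ℝ}
    (hC : ∀ p, H p ≤ C) :
    ∫ a : Obs d, H (a.1.1, a.2) * ξ a.1 ∂(ν.prod τ)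
      ≤ ∫ a : Obs d, H (a.1.1, a.2) * c ∂(ν.prod τ) := by
  have hm : MeasurableSpace.comap Prod.fst inferInstance
      ≤ (inferInstance : MeasurableSpace (Space d × ℝ)) := measurable_fst.comap_le
  have hC' : ∀ p, |H p| ≤ C := fun p => (abs_of_nonneg (hH0 p)).trans_le (hC p)
  have hb : ∀ {f : Space d × ℝ → ℝ}, Integrable f ν →
      Integrable (fun a : Obs d => H (a.1.1, a.2) * f a.1) (ν.prod τ) := fun hf =>
    (hf.comp_fst τ).bdd_mul (c := C) (hH.comp (by fun_prop)).aestronglyMeasurable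
      (.of_forall fun a => hC' _)
  rw [integral_mul_eq_integral_condExp_mul ν τ hξ hH hC',
    ← integral_prod_symm _ (hb integrable_condExp)]
  refine integral_mono_ae (hb integrable_condExp) (hb (integrable_const c)) ?_
  filter_upwards [Measure.quasiMeasurePreserving_fst.ae hc] with a ha
  exact mul_le_mul_of_nonneg_left ha (hH0 _)

end Obs

/-- The second moment of a weighted sum of conditionally centered noise variables, when the weights
depend on the covariates and the tie-breaking variables only. -/
theorem integral_sq_sum_baggedWeight_le {d N k : ℕ} (hk : 0 < k) (hN : 0 < N)
    (ν : Measure (Space d × ℝ)) [IsProbabilityMeasure ν]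
    (τ : Measure ℝ) [IsProbabilityMeasure τ] (x : Space d) {ξ : Space d × ℝ → ℝ}
    (hξ : MemLp ξ 2 ν) {σ : ℝ}
    (h0 : ν[ξ | MeasurableSpace.comap Prod.fst inferInstance] =ᵐ[ν] 0)
    (hσ : ν[ξ ^ 2 | MeasurableSpace.comap Prod.fst inferInstance] ≤ᵐ[ν] fun _ => σ ^ 2) :
    Integrable (fun z : Fin N → Obs d => (∑ i, baggedWeight hk z x i * ξ (z i).1) ^ 2)
      (Measure.pi fun _ => ν.prod τ) ∧
    ∫ z : Fin N → Obs d, (∑ i, baggedWeight hk z x i * ξ (z i).1) ^ 2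
      ∂(Measure.pi fun _ => ν.prod τ) ≤ σ ^ 2 * (k / N) := by
  set Q := ν.prod τ with hQ
  set M : Measure (Fin N → Obs d) := Measure.pi fun _ => Q with hM
  set w := fun (z : Fin N → Obs d) i => baggedWeight hk z x i with hw
  have hwm : ∀ i, Measurable fun z => w z i := fun i => measurable_baggedWeight hk x i
  have hw0 : ∀ z i, 0 ≤ w z i := fun z i => baggedWeight_nonneg hk z x i
  have hw1 : ∀ z i, w z i ≤ 1 := fun z i => baggedWeight_le_one hk hN z x i
  -- Overwriting the response of observation `i`, below by `0`, leaves the weights unchanged; this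
  -- exhibits them as functions of its covariate and tie-breaker alone.
  have hwc : ∀ z i (a : Obs d) (y : ℝ),
      w (Function.update z i a) = w (Function.update z i ((a.1.1, y), a.2)) := by
    intro z i a y
    refine baggedWeight_congr hk x fun j => ?_
    by_cases hj : j = i
    · subst hj; simp
    · simp [hj]
  have hξ1 : Integrable ξ ν := hξ.integrable one_le_two
  have hξM : ∀ i, MemLp (fun z : Fin N → Obs d => ξ (z i).1) 2 M := fun i =>
    (hξ.comp_measurePreserving measurePreserving_fst).comp_measurePreserving
      (measurePreserving_eval (fun _ : Fin N => Q) i)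
  have hint : ∀ i j, Integrable (fun z => (w z i * ξ (z i).1) * (w z j * ξ (z j).1)) M := by
    intro i j
    have h := ((hξM i).integrable_mul (hξM j)).bdd_mul (c := 1)
      ((hwm i).mul (hwm j)).aestronglyMeasurable (.of_forall fun z => ?_)
    · refine h.congr (.of_forall fun z => ?_)
      simp only [Pi.mul_apply]
      ring
    · simp only [Pi.mul_apply]
      rw [Real.norm_of_nonneg (mul_nonneg (hw0 _ _) (hw0 _ _))]
      exact mul_le_one₀ (hw1 _ _) (hw0 _ _) (hw1 _ _)
  have hsq : ∀ z, (∑ i, w z i * ξ (z i).1) ^ 2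
      = ∑ i, ∑ j, (w z i * ξ (z i).1) * (w z j * ξ (z j).1) := fun z => by
    rw [sq, Finset.sum_mul_sum]
  have hwint : ∀ i, Integrable (fun z => w z i ^ 2 * σ ^ 2) M := fun i =>
    (Integrable.of_bound (C := 1) ((hwm i).pow_const 2).aestronglyMeasurable
      (.of_forall fun z => by
        rw [Real.norm_of_nonneg (sq_nonneg _)]
        exact pow_le_one₀ (hw0 _ _) (hw1 _ _))).mul_const _
  -- Freeze all observations but `i`: the weights and `ξ (z j).1` do not see its response, and its
  -- noise is conditionally centered.
  have hoff : ∀ i j, j ≠ i → ∫ z, (w z i * ξ (z i).1) * (w z j * ξ (z j).1) ∂M = 0 := by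
    intro i j hji
    rw [(integral_pi_eq_integral_update Q i (hint i j)).2]
    refine integral_eq_zero_of_ae (.of_forall fun z => ?_)
    set H : Space d × ℝ → ℝ := fun p => w (Function.update z i ((p.1, 0), p.2)) i *
      (w (Function.update z i ((p.1, 0), p.2)) j * ξ (z j).1) with hH
    have hu : Measurable fun p : Space d × ℝ => Function.update z i ((p.1, 0), p.2) :=
      (measurable_update z).comp (by fun_prop)
    have hHm : Measurable H := ((hwm i).comp hu).mul (((hwm j).comp hu).mul_const _)
    refine Eq.trans (integral_congr_ae (.of_forall fun a => ?_))
      (integral_mul_eq_zero_of_condExp_eq_zero ν τ hξ1 h0 hHm (C := |ξ (z j).1|) fun p => ?_)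
    · simp only [hH, Function.update_self, Function.update_of_ne hji]
      rw [hwc z i a 0]
      ring
    · rw [abs_mul, abs_mul, abs_of_nonneg (hw0 _ _), abs_of_nonneg (hw0 _ _)]
      exact (mul_le_of_le_one_left (mul_nonneg (hw0 _ _) (abs_nonneg _)) (hw1 _ _)).trans
        (mul_le_of_le_one_left (abs_nonneg _) (hw1 _ _))
  have hdiag : ∀ i, ∫ z, (w z i * ξ (z i).1) * (w z i * ξ (z i).1) ∂M
      ≤ ∫ z, w z i ^ 2 * σ ^ 2 ∂M := by
    intro i
    refine integral_pi_mono_of_update Q i (hint i i) (hwint i) fun z => ?_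
    set H : Space d × ℝ → ℝ := fun p => w (Function.update z i ((p.1, 0), p.2)) i ^ 2 with hH
    have hu : Measurable fun p : Space d × ℝ => Function.update z i ((p.1, 0), p.2) :=
      (measurable_update z).comp (by fun_prop)
    have hHm : Measurable H := ((hwm i).comp hu).pow_const 2
    have h := integral_mul_le_of_condExp_le ν τ hξ.integrable_sq hσ hHm (fun p => sq_nonneg _)
      (C := 1) (fun p => pow_le_one₀ (hw0 _ _) (hw1 _ _))
    refine le_trans (le_of_eq ?_) (h.trans_eq ?_)
    · refine integral_congr_ae (.of_forall fun a => ?_)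
      simp only [hH, Function.update_self]
      rw [hwc z i a 0]
      ring
    · refine integral_congr_ae (.of_forall fun a => ?_)
      simp only [hH]
      rw [hwc z i a 0]
  simp only [show ∀ z i, baggedWeight hk z x i = w z i from fun _ _ => rfl, hsq]
  refine ⟨integrable_finsetSum _ fun i _ => integrable_finsetSum _ fun j _ => hint i j, ?_⟩
  rw [integral_finsetSum _ fun i _ => integrable_finsetSum _ fun j _ => hint i j]
  calc _ = ∑ i, ∫ z, (w z i * ξ (z i).1) * (w z i * ξ (z i).1) ∂M := by
        refine Finset.sum_congr rfl fun i _ => ?_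
        rw [integral_finsetSum _ fun j _ => hint i j]
        exact Finset.sum_eq_single i (fun j _ hj => hoff i j hj) (by simp)
    _ ≤ ∑ i, ∫ z, w z i ^ 2 * σ ^ 2 ∂M := Finset.sum_le_sum fun i _ => hdiag i
    _ = ∫ z, (∑ i, w z i ^ 2) * σ ^ 2 ∂M := by
        rw [← integral_finsetSum _ fun i _ => hwint i]
        simp only [Finset.sum_mul]
    _ ≤ ∫ z, (k / N : ℝ) * σ ^ 2 ∂M := by
        refine integral_mono ?_ (integrable_const _) fun z => ?_
        · simp only [Finset.sum_mul]
          exact integrable_finsetSum _ fun i _ => hwint i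
        · exact mul_le_mul_of_nonneg_right (sum_baggedWeight_sq_le hk hN z x) (sq_nonneg σ)
    _ = _ := by simp [mul_comm]

/-! ### Nearest neighbor distance in a resample -/

/-- The probability that a resample of size `k` misses the set `A`. -/
theorem integral_frac_notMem_pow_le {α : Type*} [MeasurableSpace α] (Q : Measure α)
    [IsProbabilityMeasure Q] {A : Set α} (hA : MeasurableSet A) {k N : ℕ} (hN : 0 < N)
    (hkN : k ≤ N) :
    ∫ z : Fin N → α, ((N : ℝ)⁻¹ * ∑ i, Aᶜ.indicator 1 (z i)) ^ k ∂(Measure.pi fun _ => Q)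
      ≤ Real.exp (-(Q.real A * k / 2)) := by
  have hN' : (0 : ℝ) < N := by exact_mod_cast hN
  set u : ℝ := k / N with hu
  have hu0 : 0 ≤ u := by positivity
  have hu1 : u ≤ 1 := (div_le_one hN').2 (by exact_mod_cast hkN)
  set q := Q.real A with hq
  have hq0 : 0 ≤ q := measureReal_nonneg
  -- By `1 - a ≤ exp (-a)`, with `a` the fraction of observations in `A`, the `k`-th power is
  -- bounded by a product of independent factors `φ`.
  set φ : α → ℝ := fun a => Real.exp (-(u * A.indicator 1 a)) with hφ
  have hφm : Measurable φ := by
    have := (measurable_one (α := ℝ) (β := α)).indicator hA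
    fun_prop
  have hφi : Integrable φ Q := Integrable.of_bound (C := 1) hφm.aestronglyMeasurable
    (.of_forall fun a => by
      rw [Real.norm_of_nonneg (Real.exp_nonneg _), Real.exp_le_one_iff, neg_nonpos]
      exact mul_nonneg hu0 (Set.indicator_nonneg (fun _ _ => zero_le_one) a))
  have hpt : ∀ z : Fin N → α, ((N : ℝ)⁻¹ * ∑ i, Aᶜ.indicator 1 (z i)) ^ k ≤ ∏ i, φ (z i) := by
    intro z
    have h0 : 0 ≤ (N : ℝ)⁻¹ * ∑ i, Aᶜ.indicator (1 : α → ℝ) (z i) :=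
      mul_nonneg (by positivity)
        (Finset.sum_nonneg fun i _ => Set.indicator_nonneg (fun _ _ => zero_le_one) _)
    have h1 : (N : ℝ)⁻¹ * ∑ i, Aᶜ.indicator (1 : α → ℝ) (z i)
        = -((N : ℝ)⁻¹ * ∑ i, A.indicator (1 : α → ℝ) (z i)) + 1 := by
      simp only [Set.indicator_compl, Pi.sub_apply, Pi.one_apply, Finset.sum_sub_distrib]
      simp only [Finset.sum_const, Finset.card_univ, Fintype.card_fin, nsmul_eq_mul, mul_one]
      field_simp
      ring
    calc _ ≤ Real.exp (-((N : ℝ)⁻¹ * ∑ i, A.indicator (1 : α → ℝ) (z i))) ^ k := by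
          refine pow_le_pow_left₀ h0 ?_ k
          rw [h1]
          exact Real.add_one_le_exp _
      _ = _ := by
          rw [← Real.exp_nat_mul, ← Real.exp_sum]
          congr 1
          rw [Finset.sum_neg_distrib, ← Finset.mul_sum, hu]
          ring
  have hint : ∫ a, φ a ∂Q ≤ Real.exp (-(q * (u / 2))) := by
    have e : φ = fun a => 1 - (1 - Real.exp (-u)) * A.indicator 1 a := by
      ext a
      by_cases ha : a ∈ A <;> simp [hφ, ha]
    have hi : Integrable (A.indicator (1 : α → ℝ)) Q :=
      (integrable_const (1 : ℝ)).indicator hA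
    rw [e, integral_sub (integrable_const _) (hi.const_mul _), integral_const_mul,
      integral_indicator_one hA]
    simp only [integral_const, probReal_univ, smul_eq_mul, mul_one, ← hq]
    -- This is where `k ≤ N`, that is `u ≤ 1`, enters.
    have h2 : u / 2 ≤ 1 - Real.exp (-u) := by
      have h3 : Real.exp (-u) ≤ 1 / (1 + u) := by
        rw [Real.exp_neg, ← one_div]
        exact one_div_le_one_div_of_le (by positivity) (by linarith [Real.add_one_le_exp u])
      have h4 : 1 / (1 + u) ≤ 1 - u / 2 := by
        rw [div_le_iff₀ (by positivity)]
        nlinarith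
      linarith
    nlinarith [Real.add_one_le_exp (-(q * (u / 2))), mul_le_mul_of_nonneg_left h2 hq0]
  calc _ ≤ ∫ z : Fin N → α, ∏ i, φ (z i) ∂(Measure.pi fun _ => Q) :=
        integral_mono_of_nonneg (.of_forall fun z => pow_nonneg (mul_nonneg (by positivity)
          (Finset.sum_nonneg fun i _ => Set.indicator_nonneg (fun _ _ => zero_le_one) _)) _)
          (Integrable.fintype_prod fun _ => hφi) (.of_forall hpt)
    _ = (∫ a, φ a ∂Q) ^ N := by
        rw [integral_fintype_prod_eq_pow, Fintype.card_fin]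
    _ ≤ Real.exp (-(q * (u / 2))) ^ N :=
        pow_le_pow_left₀ (integral_nonneg fun a => Real.exp_nonneg _) hint N
    _ = _ := by
        rw [← Real.exp_nat_mul, hu]
        congr 1
        field_simp

/-- The mean distance from `x` to the nearest neighbor in a resample, when the tail of this
distance is exponentially small. -/
theorem lintegral_sum_baggedWeight_mul_norm_le {d N k : ℕ} (hk : 0 < k)
    (Q : Measure (Obs d)) [IsProbabilityMeasure Q] (x : Space d) {s : ℝ} (hs : 0 < s)
    (htail : ∀ t > 0, ∫ z : Fin N → Obs d,
      ((N : ℝ)⁻¹ * ∑ i, {a : Obs d | ‖a.1.1 - x‖ ≤ t}ᶜ.indicator 1 (z i)) ^ k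
        ∂(Measure.pi fun _ => Q) ≤ 2 * Real.exp (-(1 / (4 * s)) * t)) :
    ∫⁻ z : Fin N → Obs d, ENNReal.ofReal (∑ i, baggedWeight hk z x i * ‖(z i).1.1 - x‖)
      ∂(Measure.pi fun _ => Q) ≤ ENNReal.ofReal (8 * s) := by
  set M : Measure (Fin N → Obs d) := Measure.pi fun _ => Q with hM
  set D := fun (I : Fin k → Fin N) (z : Fin N → Obs d) =>
    ‖(z (nearestIndex hk z x I)).1.1 - x‖ with hD
  have hlt : ∀ I t, {z | t < D I z} = ⋂ l, {z : Fin N → Obs d | t < ‖(z (I l)).1.1 - x‖} := by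
    intro I t
    ext z
    simp only [Set.mem_ofPred_eq, Set.mem_iInter, hD]
    exact lt_norm_nearestIndex_iff hk z x I t
  have hms : ∀ I t, MeasurableSet {z | t < D I z} := fun I t => by
    rw [hlt]
    exact .iInter fun l => measurableSet_lt measurable_const (by fun_prop)
  have hDm : ∀ I, Measurable (D I) := fun I => measurable_of_Ioi fun t => hms I t
  -- Expand the `k`-th power of the sum over all maps `I`: each product of indicators says that
  -- every draw is farther than `t`.
  have hpt : ∀ t z, ((N : ℝ) ^ k)⁻¹ * ∑ I : Fin k → Fin N, {z | t < D I z}.indicator 1 z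
      = ((N : ℝ)⁻¹ * ∑ i, {a : Obs d | ‖a.1.1 - x‖ ≤ t}ᶜ.indicator 1 (z i)) ^ k := by
    intro t z
    rw [mul_pow, inv_pow, Fintype.sum_pow]
    congr 1
    refine Finset.sum_congr rfl fun I _ => ?_
    rw [hlt]
    by_cases h : ∀ l, t < ‖(z (I l)).1.1 - x‖
    · simp [Set.indicator, h]
    · rw [Set.indicator_of_notMem (by simpa using h)]
      push Not at h
      obtain ⟨l, hl⟩ := h
      exact (Finset.prod_eq_zero (Finset.mem_univ l) (by simp [Set.indicator, hl])).symm
  have hTt : ∀ t > 0, ∑ I : Fin k → Fin N, ENNReal.ofReal ((N : ℝ) ^ k)⁻¹ * M {z | t < D I z}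
      ≤ ENNReal.ofReal (2 * Real.exp (-(1 / (4 * s)) * t)) := by
    intro t ht
    refine le_trans (le_of_eq ?_) (ENNReal.ofReal_le_ofReal (htail t ht))
    simp only [← hpt]
    have hi : ∀ I, Integrable ({z | t < D I z}.indicator (1 : (Fin N → Obs d) → ℝ)) M := fun I =>
      (integrable_const (1 : ℝ)).indicator (hms I t)
    rw [integral_const_mul, integral_finsetSum _ fun I _ => hi I,
      ENNReal.ofReal_mul (by positivity)]
    simp only [integral_indicator_one (hms _ t)]
    rw [ENNReal.ofReal_sum_of_nonneg fun I _ => measureReal_nonneg, Finset.mul_sum]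
    exact Finset.sum_congr rfl fun I _ => by rw [ofReal_measureReal]
  calc ∫⁻ z, ENNReal.ofReal (∑ i, baggedWeight hk z x i * ‖(z i).1.1 - x‖) ∂M
      = ∫⁻ z, ∑ I, ENNReal.ofReal ((N : ℝ) ^ k)⁻¹ * ENNReal.ofReal (D I z) ∂M := by
        refine lintegral_congr fun z => ?_
        rw [sum_baggedWeight_mul hk z x fun i => ‖(z i).1.1 - x‖, ENNReal.ofReal_mul (by positivity),
          ENNReal.ofReal_sum_of_nonneg fun I _ => norm_nonneg _, Finset.mul_sum]
    -- Layer-cake formula; with `∫⁻`, no integrability of the distances is needed.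
    _ = ∑ I, ENNReal.ofReal ((N : ℝ) ^ k)⁻¹ * ∫⁻ t in Set.Ioi 0, M {z | t < D I z} := by
        rw [lintegral_finsetSum _ fun I _ => ((hDm I).ennreal_ofReal).const_mul _]
        refine Finset.sum_congr rfl fun I _ => ?_
        rw [lintegral_const_mul _ (hDm I).ennreal_ofReal, lintegral_eq_lintegral_meas_lt M
          (.of_forall fun z => norm_nonneg _) (hDm I).aemeasurable]
    _ = ∫⁻ t in Set.Ioi 0, ∑ I, ENNReal.ofReal ((N : ℝ) ^ k)⁻¹ * M {z | t < D I z} := by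
        have hmt : ∀ I, Measurable fun t => M {z | t < D I z} := fun I =>
          Antitone.measurable fun t t' h => measure_mono fun z hz => lt_of_le_of_lt h hz
        rw [lintegral_finsetSum _ fun I _ => (hmt I).const_mul _]
        exact Finset.sum_congr rfl fun I _ => (lintegral_const_mul _ (hmt I)).symm
    _ ≤ ∫⁻ t in Set.Ioi 0, ENNReal.ofReal (2 * Real.exp (-(1 / (4 * s)) * t)) :=
        setLIntegral_mono' measurableSet_Ioi fun t ht => hTt t ht
    _ = ENNReal.ofReal (8 * s) := by
        have ha : -(1 / (4 * s)) < 0 := by simpa using hs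
        rw [← ofReal_integral_eq_lintegral_ofReal ((integrableOn_exp_mul_Ioi ha 0).const_mul 2)
          (.of_forall fun t => by positivity), integral_const_mul, integral_exp_mul_Ioi ha]
        congr 1
        simp
        ring

/-! ### Deviation of one bagged estimate -/

section InClass

variable {d : ℕ} {ρ σ : ℝ} {ν : Measure (Space d × ℝ)} [IsProbabilityMeasure ν]
  {r : Space d → ℝ}

/-- A measurable version of the regression function, and the properties of the noise. -/
theorem InClass.exists_measurable (hν : InClass ρ σ ν r) :
    ∃ g : Space d → ℝ, Measurable g ∧ (∀ᵐ p ∂ν, r p.1 = g p.1) ∧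
      MemLp (fun p : Space d × ℝ => p.2 - g p.1) 2 ν ∧
      ν[fun p : Space d × ℝ => p.2 - g p.1 | MeasurableSpace.comap Prod.fst inferInstance]
        =ᵐ[ν] 0 ∧
      ν[(fun p : Space d × ℝ => p.2 - g p.1) ^ 2 | MeasurableSpace.comap Prod.fst inferInstance]
        ≤ᵐ[ν] fun _ => σ ^ 2 := by
  have hm : MeasurableSpace.comap Prod.fst inferInstance
      ≤ (inferInstance : MeasurableSpace (Space d × ℝ)) := measurable_fst.comap_le
  -- `r` is not assumed measurable, so the conditional expectation itself is factored through `X`.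
  obtain ⟨g, hg, hgf⟩ := (stronglyMeasurable_condExp (μ := ν) (m := MeasurableSpace.comap Prod.fst
    inferInstance) (f := fun p : Space d × ℝ => p.2)).measurable.exists_eq_measurable_comp
  have hrg : ∀ᵐ p ∂ν, r p.1 = g p.1 := by
    filter_upwards [hν.regression] with p hp
    rw [← hp, hgf]
    rfl
  set ξ : Space d × ℝ → ℝ := fun p => p.2 - g p.1 with hξdef
  have hY := hν.memLp
  have hξe : ξ = (fun p : Space d × ℝ => p.2) -
      ν[fun p : Space d × ℝ => p.2 | MeasurableSpace.comap Prod.fst inferInstance] := by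
    rw [hgf]
    rfl
  have hξ : MemLp ξ 2 ν := by
    rw [hξe]
    exact hY.sub (hY.condExp one_le_two)
  have h0 : ν[ξ | MeasurableSpace.comap Prod.fst inferInstance] =ᵐ[ν] 0 := by
    rw [hξe]
    refine (condExp_sub (hY.integrable one_le_two) integrable_condExp _).trans ?_
    rw [condExp_of_stronglyMeasurable hm stronglyMeasurable_condExp integrable_condExp]
    simp
  refine ⟨g, hg, hrg, hξ, h0, ?_⟩
  have h1 : (fun p : Space d × ℝ => p.2 - r p.1) =ᵐ[ν] ξ := by
    filter_upwards [hrg] with p hp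
    simp only [hξdef, hp]
  have h2 : Var[ξ; ν | MeasurableSpace.comap Prod.fst inferInstance]
      =ᵐ[ν] ν[ξ ^ 2 | MeasurableSpace.comap Prod.fst inferInstance] := by
    -- The conditional variance subtracts the conditional mean of `ξ`, which vanishes.
    refine condExp_congr_ae ?_
    filter_upwards [h0] with p hp
    simp [hp]
  filter_upwards [hν.noise, condVar_congr_ae h1, h2] with p hp1 hp2 hp3
  rw [← hp3, ← hp2]
  exact hp1

theorem fst_mem_support_ae (ν : Measure (Space d × ℝ)) : ∀ᵐ p ∂ν, p.1 ∈ ν.fst.support :=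
  ae_of_ae_map measurable_fst.aemeasurable (Measure.support_mem_ae (μ := ν.fst))

/-- The tail of the distance from `x` to its nearest neighbor in a resample. -/
theorem InClass.integral_frac_norm_gt_pow_le (hν : InClass ρ σ ν r) (hd : 1 ≤ d)
    (τ : Measure ℝ) [IsProbabilityMeasure τ] {k N : ℕ} (hk : 0 < k) (hkN : k ≤ N)
    {x : Space d} (hx : x ∈ ν.fst.support) {s : ℝ} (hs : 0 < s) (hks : 1 / 2 ≤ k * ρ * s ^ d)
    {t : ℝ} (ht : 0 < t) :
    ∫ z : Fin N → Obs d,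
      ((N : ℝ)⁻¹ * ∑ i, {a : Obs d | ‖a.1.1 - x‖ ≤ t}ᶜ.indicator 1 (z i)) ^ k
        ∂(Measure.pi fun _ => ν.prod τ) ≤ 2 * Real.exp (-(1 / (4 * s)) * t) := by
  have hA : MeasurableSet {a : Obs d | ‖a.1.1 - x‖ ≤ t} :=
    measurableSet_le (by fun_prop) measurable_const
  rcases le_or_gt t (Metric.diam ν.fst.support) with htD | htD
  · have hq : ρ * t ^ d ≤ (ν.prod τ).real {a : Obs d | ‖a.1.1 - x‖ ≤ t} := by
      refine (hν.ball x hx t ⟨ht, htD⟩).trans_eq ?_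
      have hB : MeasurableSet (Metric.closedBall x t) := Metric.isClosed_closedBall.measurableSet
      rw [Measure.fst, map_measureReal_apply measurable_fst hB,
        ← Measure.fst_prod (μ := ν) (ν := τ), Measure.fst,
        map_measureReal_apply measurable_fst (measurable_fst hB)]
      congr 1
      ext a
      simp
    refine (integral_frac_notMem_pow_le (ν.prod τ) hA (hk.trans_le hkN) hkN).trans ?_
    have h1 : (t / s) ^ d / 4 ≤ (ν.prod τ).real {a : Obs d | ‖a.1.1 - x‖ ≤ t} * k / 2 := by
      have hst : t ^ d = (t / s) ^ d * s ^ d := by rw [div_pow]; field_simp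
      have h2 : 0 ≤ (t / s) ^ d := by positivity
      have h3 := mul_le_mul_of_nonneg_right hq (Nat.cast_nonneg (α := ℝ) k)
      have h4 : (t / s) ^ d * (1 / 2) ≤ (t / s) ^ d * (k * ρ * s ^ d) := by gcongr
      rw [hst] at h3
      linarith
    -- Linearizing the exponent gives an exponential tail in every dimension, at the cost of a
    -- factor `e ^ (1/4) ≤ 2`.
    have h5 : t / s - 1 ≤ (t / s) ^ d := by
      rcases le_total 1 (t / s) with h | h
      · linarith [le_self_pow₀ h (by omega : d ≠ 0)]
      · linarith [show 0 ≤ (t / s) ^ d by positivity]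
    calc _ ≤ Real.exp (1 / 4 + -(1 / (4 * s)) * t) := by
          refine Real.exp_le_exp.2 ?_
          have : -(1 / (4 * s)) * t = -(t / s / 4) := by field_simp
          linarith
      _ ≤ _ := by
          rw [Real.exp_add]
          gcongr
          have h := Real.one_sub_le_exp_neg (1 / 4)
          have h6 : Real.exp (1 / 4) * Real.exp (-(1 / 4)) = 1 := by simp [← Real.exp_add]
          nlinarith [Real.exp_pos (1 / 4)]
  -- Beyond the diameter the ball condition is silent, but almost surely no observation is that far
  -- from `x`.
  · have h0 : ∀ᵐ z ∂(Measure.pi fun _ : Fin N => ν.prod τ),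
        ((N : ℝ)⁻¹ * ∑ i, {a : Obs d | ‖a.1.1 - x‖ ≤ t}ᶜ.indicator 1 (z i)) ^ k = 0 := by
      have h1 : ∀ᵐ z ∂(Measure.pi fun _ : Fin N => ν.prod τ),
          ∀ i, (z i).1.1 ∈ ν.fst.support := by
        rw [ae_all_iff]
        intro i
        exact (measurePreserving_eval (fun _ : Fin N => ν.prod τ) i).quasiMeasurePreserving.ae
          (Measure.quasiMeasurePreserving_fst.ae (fst_mem_support_ae ν))
      filter_upwards [h1] with z hz
      rw [Finset.sum_eq_zero, mul_zero, zero_pow hk.ne']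
      intro i _
      refine Set.indicator_of_notMem ?_ _
      simp only [Set.mem_compl_iff, Set.mem_ofPred_eq, not_not, ← dist_eq_norm]
      exact (Metric.dist_le_diam_of_mem hν.bounded (hz i) hx).trans htD.le
    rw [integral_eq_zero_of_ae h0]
    positivity

/-- The deviation probability of one bagged estimate. -/
theorem InClass.measure_bagged_le (hν : InClass ρ σ ν r) (hd : 1 ≤ d)
    (τ : Measure ℝ) [IsProbabilityMeasure τ] {k N : ℕ} (hk : 0 < k) (hkN : k ≤ N)
    {x : Space d} (hx : x ∈ ν.fst.support) {s : ℝ} (hs : 0 < s) (hks : 1 / 2 ≤ k * ρ * s ^ d)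
    {ε : ℝ} (hε : 0 < ε) :
    (Measure.pi fun _ : Fin N => ν.prod τ) {z | ε ≤ |bagged k z x - r x|}
      ≤ ENNReal.ofReal (8 * s / (ε / 2) + σ ^ 2 * (k / N) / (ε / 2) ^ 2) := by
  have hN : 0 < N := hk.trans_le hkN
  obtain ⟨g, hg, hrg, hξ, h0, hvar⟩ := hν.exists_measurable
  set ξ : Space d × ℝ → ℝ := fun p => p.2 - g p.1 with hξdef
  set M : Measure (Fin N → Obs d) := Measure.pi fun _ => ν.prod τ with hM
  set W := fun z : Fin N → Obs d => ∑ i, baggedWeight hk z x i * ‖(z i).1.1 - x‖ with hW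
  set V := fun z : Fin N → Obs d => (∑ i, baggedWeight hk z x i * ξ (z i).1) ^ 2 with hV
  obtain ⟨hVi, hVle⟩ := integral_sq_sum_baggedWeight_le hk hN ν τ x hξ h0 hvar
  have hWm : Measurable W := Finset.measurable_sum _ fun i _ =>
    (measurable_baggedWeight hk x i).mul (by fun_prop)
  have hWle : ∫⁻ z, ENNReal.ofReal (W z) ∂M ≤ ENNReal.ofReal (8 * s) :=
    lintegral_sum_baggedWeight_mul_norm_le hk (ν.prod τ) x hs fun t ht =>
      hν.integral_frac_norm_gt_pow_le hd τ hk hkN hx hs hks ht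
  have hsub : ∀ᵐ z ∂M, z ∈ {z | ε ≤ |bagged k z x - r x|} →
      z ∈ {z | ENNReal.ofReal (ε / 2) ≤ ENNReal.ofReal (W z)} ∪
        {z | ENNReal.ofReal ((ε / 2) ^ 2) ≤ ENNReal.ofReal (V z)} := by
    have h1 : ∀ᵐ z ∂M, ∀ i, (z i).1.1 ∈ ν.fst.support ∧ r (z i).1.1 = g (z i).1.1 := by
      rw [ae_all_iff]
      intro i
      exact (measurePreserving_eval (fun _ : Fin N => ν.prod τ) i).quasiMeasurePreserving.ae
        (Measure.quasiMeasurePreserving_fst.ae ((fst_mem_support_ae ν).and hrg))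
    filter_upwards [h1] with z hz hε'
    have hdec : bagged k z x - r x = ∑ i, baggedWeight hk z x i * ξ (z i).1 +
        ∑ i, baggedWeight hk z x i * (r (z i).1.1 - r x) := by
      calc _ = ∑ i, baggedWeight hk z x i * (z i).1.2
            - (∑ i, baggedWeight hk z x i) * r x := by
            rw [bagged_eq_sum_baggedWeight hk, sum_baggedWeight hk hN, one_mul]
        _ = _ := by
            rw [Finset.sum_mul, ← Finset.sum_sub_distrib, ← Finset.sum_add_distrib]
            refine Finset.sum_congr rfl fun i _ => ?_
            simp only [hξdef, (hz i).2]
            ring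
    have hbias : |∑ i, baggedWeight hk z x i * (r (z i).1.1 - r x)| ≤ W z := by
      refine (Finset.abs_sum_le_sum_abs _ _).trans (Finset.sum_le_sum fun i _ => ?_)
      rw [abs_mul, abs_of_nonneg (baggedWeight_nonneg hk z x i)]
      refine mul_le_mul_of_nonneg_left ?_ (baggedWeight_nonneg hk z x i)
      have := hν.lipschitz.dist_le_mul _ (hz i).1 _ hx
      simpa [Real.dist_eq, dist_eq_norm] using this
    have hε'' : ε ≤ |bagged k z x - r x| := hε'
    rw [hdec] at hε''
    have h3 := hε''.trans (abs_add_le _ _)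
    -- Either the bias bound or the noise reaches `ε / 2`; the noise is squared for Chebyshev's
    -- inequality.
    by_cases h : ε / 2 ≤ W z
    · exact .inl (ENNReal.ofReal_le_ofReal h)
    · refine .inr (ENNReal.ofReal_le_ofReal ?_)
      simp only [hV]
      rw [← sq_abs (∑ i, _)]
      exact pow_le_pow_left₀ (by positivity) (by linarith) 2
  have hmarkov : ∀ {f : (Fin N → Obs d) → ℝ} {a b : ℝ}, 0 < a →
      AEMeasurable (fun z => ENNReal.ofReal (f z)) M →
      ∫⁻ z, ENNReal.ofReal (f z) ∂M ≤ ENNReal.ofReal b →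
      M {z | ENNReal.ofReal a ≤ ENNReal.ofReal (f z)} ≤ ENNReal.ofReal (b / a) := by
    intro f a b ha hf hb
    rw [ENNReal.ofReal_div_of_pos ha]
    refine (ENNReal.le_div_iff_mul_le (.inl (by simpa using ha)) (.inl ENNReal.ofReal_ne_top)).2 ?_
    rw [mul_comm]
    exact (mul_meas_ge_le_lintegral₀ hf _).trans hb
  calc _ ≤ _ := measure_mono_ae hsub
    _ ≤ _ := measure_union_le _ _
    _ ≤ ENNReal.ofReal (8 * s / (ε / 2)) + ENNReal.ofReal (σ ^ 2 * (k / N) / (ε / 2) ^ 2) := by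
        refine add_le_add (hmarkov (by positivity) hWm.ennreal_ofReal.aemeasurable hWle)
          (hmarkov (by positivity) hVi.aemeasurable.ennreal_ofReal ?_)
        rw [← ofReal_integral_eq_lintegral_ofReal hVi (.of_forall fun z => sq_nonneg _)]
        exact ENNReal.ofReal_le_ofReal hVle
    _ = _ := (ENNReal.ofReal_add (by positivity) (by positivity)).symm

end InClass

/-! ### From independent blocks to the median -/

/-- The law of a family of blocks of an i.i.d. sample. -/
theorem map_blocks_eq_pi {d n m N : ℕ} {ν : Measure (Space d × ℝ)} [IsProbabilityMeasure ν]
    {Ω : Type*} [MeasurableSpace Ω] {P : Measure Ω} [IsProbabilityMeasure P]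
    {Z : Fin n → Ω → Obs d}
    [IsProbabilityMeasure (volume.restrict (Set.Icc (0 : ℝ) 1))]
    (hZ : IsSample ν P Z) (block : Fin m × Fin N ↪ Fin n) :
    AEMeasurable (fun ω j i => Z (block (j, i)) ω) P ∧
    P.map (fun ω j i => Z (block (j, i)) ω) = Measure.pi fun _ : Fin m =>
      Measure.pi fun _ : Fin N => ν.prod (volume.restrict (Set.Icc (0 : ℝ) 1)) := by
  set Q := ν.prod (volume.restrict (Set.Icc (0 : ℝ) 1)) with hQ
  have hZm : ∀ i, AEMeasurable (Z i) P := fun i => (hZ.law i).aemeasurable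
  have h1 : P.map (fun ω p => Z (block p) ω) = Measure.pi fun _ : Fin m × Fin N => Q := by
    have := (iIndepFun_iff_map_fun_eq_pi_map fun p => hZm (block p)).1
      (hZ.indep.precomp block.injective)
    rw [this]
    congr 1
    ext1 p
    exact (hZ.law _).map_eq
  have hc : Measurable fun (y : Fin m × Fin N → Obs d) j i => y (j, i) := by fun_prop
  have hu : Measurable fun (z : Fin m → Fin N → Obs d) (p : Fin m × Fin N) => z p.1 p.2 := by
    fun_prop
  have hm1 : AEMeasurable (fun ω p => Z (block p) ω) P :=
    aemeasurable_pi_lambda _ fun p => hZm (block p)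
  refine ⟨hc.comp_aemeasurable hm1, ?_⟩
  have h2 : P.map (fun ω j i => Z (block (j, i)) ω)
      = (P.map (fun ω p => Z (block p) ω)).map fun y j i => y (j, i) :=
    (AEMeasurable.map_map_of_aemeasurable hc.aemeasurable hm1).symm
  rw [h2, h1, ← map_uncurry_pi_pi, Measure.map_map hc hu]
  exact Measure.map_id

/-- The median of independent estimates deviates with exponentially small probability. -/
theorem measure_le_abs_median_sub_le {α : Type*} [MeasurableSpace α] (R : Measure α)
    [IsProbabilityMeasure R] {m : ℕ} (hm : 0 < m) {f : α → ℝ} (hf : Measurable f) {ε c : ℝ}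
    (h : R {a | ε ≤ |f a - c|} ≤ ENNReal.ofReal (1 / (4 * Real.exp 1 ^ 2))) :
    (Measure.pi fun _ : Fin m => R) {z | ε ≤ |median (fun j => f (z j)) - c|}
      ≤ ENNReal.ofReal (Real.exp (-m)) := by
  set p : ℝ := 1 / (4 * Real.exp 1 ^ 2) with hp
  -- The square root of `p`: at least `m / 2` failures cost `b ^ m`, and `2 * b = 1 / e`.
  set b : ℝ := 1 / (2 * Real.exp 1) with hb
  have hb0 : 0 < b := by positivity
  have hpb : p = b ^ 2 := by
    rw [hp, hb, div_pow, mul_pow]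
    norm_num
  have hb1 : b ≤ 1 := by
    rw [hb, div_le_one (by positivity)]
    linarith [Real.add_one_le_exp 1]
  set B : Set α := {a | ε ≤ |f a - c|} with hB
  have hBm : MeasurableSet B :=
    measurableSet_le measurable_const (measurable_norm.comp (hf.sub_const c))
  have hJ : ∀ J : Finset (Fin m), m ≤ 2 * J.card →
      (Measure.pi fun _ : Fin m => R) {z | ∀ j ∈ J, z j ∈ B} ≤ ENNReal.ofReal (b ^ m) := by
    intro J hJ
    have : {z : Fin m → α | ∀ j ∈ J, z j ∈ B}
        = Set.univ.pi fun j => if j ∈ J then B else Set.univ := by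
      ext z
      simp only [Set.mem_ofPred_eq, Set.mem_univ_pi]
      refine forall_congr' fun j => ?_
      by_cases hj : j ∈ J <;> simp [hj]
    rw [this, Measure.pi_pi]
    have e : ∀ j : Fin m, R (if j ∈ J then B else Set.univ) = if j ∈ J then R B else 1 := by
      intro j
      split_ifs <;> simp
    simp only [e, Finset.prod_ite_mem, Finset.univ_inter, Finset.prod_const]
    calc R B ^ J.card ≤ ENNReal.ofReal p ^ J.card := by gcongr
      _ = ENNReal.ofReal (b ^ (2 * J.card)) := by
          rw [← ENNReal.ofReal_pow (by positivity), hpb, pow_mul]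
      _ ≤ _ := ENNReal.ofReal_le_ofReal (pow_le_pow_of_le_one hb0.le hb1 hJ)
  calc _ ≤ (Measure.pi fun _ : Fin m => R) (⋃ J ∈ Finset.univ.filter
        fun J : Finset (Fin m) => m ≤ 2 * J.card, {z | ∀ j ∈ J, z j ∈ B}) := by
        refine measure_mono fun z hz => ?_
        obtain ⟨J, hJ1, hJ2⟩ := exists_finset_of_le_abs_median_sub hm _ hz
        simp only [Set.mem_iUnion, Finset.mem_filter, Finset.mem_univ, true_and]
        exact ⟨J, hJ1, hJ2⟩
    _ ≤ ∑ J ∈ Finset.univ.filter fun J : Finset (Fin m) => m ≤ 2 * J.card,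
        (Measure.pi fun _ : Fin m => R) {z | ∀ j ∈ J, z j ∈ B} :=
        measure_biUnion_finset_le _ _
    _ ≤ ∑ J ∈ Finset.univ.filter fun J : Finset (Fin m) => m ≤ 2 * J.card,
        ENNReal.ofReal (b ^ m) :=
        Finset.sum_le_sum fun J hJ' => hJ J (Finset.mem_filter.1 hJ').2
    _ ≤ ∑ J : Finset (Fin m), ENNReal.ofReal (b ^ m) :=
        Finset.sum_le_sum_of_subset (Finset.filter_subset _ _)
    _ = ENNReal.ofReal (2 ^ m * b ^ m) := by
        rw [Finset.sum_const, Finset.card_univ, Fintype.card_finset, Fintype.card_fin,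
          nsmul_eq_mul, ENNReal.ofReal_mul (by positivity)]
        congr 1
        rw [ENNReal.ofReal_pow (by norm_num)]
        simp
    _ = _ := by
        congr 1
        rw [← mul_pow, hb, show (-(m : ℝ)) = m * (-1) by ring, Real.exp_nat_mul, Real.exp_neg]
        congr 1
        field_simp

/-! ### Choice of the resample size -/

section Parameters

variable {d : ℕ} {ρ σ t : ℝ}

theorem rpow_two_div_pow (hd : 1 ≤ d) (hρ : 0 < ρ) : (ρ ^ (2 / (d : ℝ))) ^ d = ρ ^ 2 := by
  have hd' : (d : ℝ) ≠ 0 := by positivity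
  rw [← Real.rpow_natCast, ← Real.rpow_mul hρ.le, div_mul_cancel₀ _ hd']
  norm_num

/-- Comparisons between fractional powers are made after raising to the power `d + 2`. -/
theorem rpow_one_div_add_two_pow {a : ℝ} (ha : 0 ≤ a) :
    (a ^ (1 / ((d : ℝ) + 2))) ^ (d + 2) = a := by
  have hd' : (d : ℝ) + 2 ≠ 0 := by positivity
  rw [← Real.rpow_natCast, ← Real.rpow_mul ha]
  push_cast
  rw [div_mul_cancel₀ _ hd', Real.rpow_one]

theorem rpow_div_add_two_pow {a : ℝ} (ha : 0 ≤ a) :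
    (a ^ ((d : ℝ) / ((d : ℝ) + 2))) ^ (d + 2) = a ^ d := by
  have hd' : (d : ℝ) + 2 ≠ 0 := by positivity
  rw [← Real.rpow_natCast, ← Real.rpow_mul ha]
  push_cast
  rw [div_mul_cancel₀ _ hd', Real.rpow_natCast]

/-- The resample size before rounding, at `t` observations per block. -/
theorem resampleSize_bounds (hd : 1 ≤ d) (hρ : 0 < ρ) (hσ : 0 < σ) (ht : 0 < t)
    (hc : 1 ≤ cConst d ρ σ * t) :
    1 ≤ (32 * Real.exp 1 ^ 2 * t / (ρ ^ (2 / (d : ℝ)) * σ ^ 2)) ^ ((d : ℝ) / (d + 2)) ∧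
    (32 * Real.exp 1 ^ 2 * t / (ρ ^ (2 / (d : ℝ)) * σ ^ 2)) ^ ((d : ℝ) / (d + 2)) ≤ t := by
  have hρd : 0 < ρ ^ (2 / (d : ℝ)) := Real.rpow_pos_of_pos hρ _
  have he := Real.exp_pos 1
  have hle : ∀ a, cConst d ρ σ ≤ a → 1 ≤ a * t := fun a ha =>
    hc.trans (mul_le_mul_of_nonneg_right ha ht.le)
  -- The first term of the minimum yields the upper bound by `t`, the second the lower bound by `1`.
  have h1 := hle _ ((min_le_left _ _).trans (min_le_left _ _))
  have h2 := hle _ ((min_le_left _ _).trans (min_le_right _ _))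
  set A : ℝ := 32 * Real.exp 1 ^ 2 * t / (ρ ^ (2 / (d : ℝ)) * σ ^ 2) with hA
  have hA0 : 0 < A := by positivity
  constructor
  · refine Real.one_le_rpow ?_ (by positivity)
    refine h2.trans_eq ?_
    rw [hA]
    field_simp
  · refine le_of_pow_le_pow_left₀ (n := d + 2) (by omega) ht.le ?_
    rw [rpow_div_add_two_pow hA0.le, hA, div_pow, mul_pow, mul_pow (ρ ^ _), rpow_two_div_pow hd hρ,
      div_le_iff₀ (by positivity), pow_add]
    have h3 : 1 ≤ (ρ * (σ / (4 * Real.exp 1 * √2)) ^ d * t) ^ 2 := one_le_pow₀ h1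
    have h4 : (ρ * (σ / (4 * Real.exp 1 * √2)) ^ d * t) ^ 2
        = ρ ^ 2 * (σ ^ 2) ^ d * t ^ 2 / (32 * Real.exp 1 ^ 2) ^ d := by
      have : (32 * Real.exp 1 ^ 2) = (4 * Real.exp 1 * √2) ^ 2 := by
        rw [mul_pow, Real.sq_sqrt (by norm_num)]
        ring
      rw [this, div_pow, ← pow_mul, ← pow_mul, mul_comm 2 d]
      ring
    rw [h4, le_div_iff₀ (by positivity), one_mul] at h3
    calc _ = t ^ d * (32 * Real.exp 1 ^ 2) ^ d := by ring
      _ ≤ t ^ d * (ρ ^ 2 * (σ ^ 2) ^ d * t ^ 2) := by gcongr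
      _ = _ := by ring

/-- The resample size balances the bias and the variance. -/
theorem resampleSize_balance (hd : 1 ≤ d) (hρ : 0 < ρ) (hσ : 0 < σ) (ht : 0 < t) {K s : ℝ}
    (hK : K = (32 * Real.exp 1 ^ 2 * t / (ρ ^ (2 / (d : ℝ)) * σ ^ 2)) ^ ((d : ℝ) / (d + 2)))
    (hs : s = (σ ^ 2 / (ρ * t)) ^ (1 / ((d : ℝ) + 2))) :
    1 ≤ K * ρ * s ^ d ∧ σ ^ 2 * (K / t) ≤ 32 * Real.exp 1 ^ 2 * s ^ 2 := by
  have hρd : 0 < ρ ^ (2 / (d : ℝ)) := Real.rpow_pos_of_pos hρ _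
  have he := Real.exp_pos 1
  set b : ℝ := 32 * Real.exp 1 ^ 2 with hb
  have hb1 : 1 ≤ b := by
    have := one_le_pow₀ (n := 2) (Real.one_le_exp zero_le_one)
    linarith
  have hK0 : 0 < K := by rw [hK]; positivity
  have hs0 : 0 < s := by rw [hs]; positivity
  have hKp : K ^ (d + 2) = b ^ d * t ^ d / (ρ ^ 2 * (σ ^ 2) ^ d) := by
    rw [hK, rpow_div_add_two_pow (by positivity), div_pow, mul_pow, mul_pow (ρ ^ _),
      rpow_two_div_pow hd hρ]
  have hsp : s ^ (d + 2) = σ ^ 2 / (ρ * t) := by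
    rw [hs, rpow_one_div_add_two_pow (by positivity)]
  constructor
  · refine le_of_pow_le_pow_left₀ (n := d + 2) (by omega) (by positivity) ?_
    -- The power `d + 2` of the right side is exactly `b ^ d`.
    rw [one_pow, mul_pow, mul_pow, hKp, pow_right_comm s, hsp, div_pow, mul_pow ρ t]
    refine (one_le_pow₀ hb1 (n := d)).trans_eq ?_
    field_simp
    ring
  · refine le_of_pow_le_pow_left₀ (n := d + 2) (by omega) (by positivity) ?_
    rw [mul_pow, div_pow, hKp, mul_pow b, pow_right_comm s, hsp]
    -- Here only `b ^ d ≤ b ^ (d + 2)` is lost.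
    calc _ = b ^ d * (σ ^ 2 / (ρ * t)) ^ 2 := by
          field_simp
          ring
      _ ≤ _ := by
          gcongr
          · omega

end Parameters

end MoMReg

end

/-! ### Assembly -/

theorem mainTheorem4 {d n : ℕ} (hd : 1 ≤ d) {ρ σ : ℝ} (hρ : 0 < ρ) (hσ : 0 < σ)
    (ν : Measure (MoMReg.Space d × ℝ)) [IsProbabilityMeasure ν] (r : MoMReg.Space d → ℝ)
    (hν : MoMReg.InClass ρ σ ν r)
    {Ω : Type*} [MeasurableSpace Ω] (P : Measure Ω) [IsProbabilityMeasure P]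
    (Z : Fin n → Ω → MoMReg.Obs d) (hZ : MoMReg.IsSample ν P Z)
    (δ : ℝ) (hδ : δ ∈ Set.Ico (Real.exp (-(MoMReg.cConst d ρ σ * n) + 1)) 1)
    (m N k : ℕ) (hm : m = MoMReg.numBlocks δ) (hN : N = n / m)
    (hk : k = MoMReg.kStar d ρ σ n m) :
    (1 ≤ m ∧ (m : ℝ) ≤ MoMReg.cConst d ρ σ * n) ∧ (1 ≤ k ∧ k ≤ N) ∧
      ∀ block : Fin m × Fin N ↪ Fin n, ∀ x ∈ ν.fst.support,
        P {ω | 128 * Real.exp 1 ^ 3 * (σ ^ 2 * (m : ℝ) / (ρ * n)) ^ (1 / ((d : ℝ) + 2)) ≤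
            |MoMReg.momBagged k block (fun i => Z i ω) x - r x|} ≤ ENNReal.ofReal δ := by
  obtain ⟨hδ1, hδ2⟩ := hδ
  have he := Real.exp_pos 1
  have he1 : 1 ≤ Real.exp 1 := Real.one_le_exp zero_le_one
  have hδ0 : 0 < δ := (Real.exp_pos _).trans_le hδ1
  have hlog0 : 0 < Real.log (1 / δ) := Real.log_pos (one_lt_one_div hδ0 hδ2)
  -- The `+ 1` in the lower bound on `δ` pays for the ceiling in `m`.
  have hlog1 : Real.log (1 / δ) ≤ MoMReg.cConst d ρ σ * n - 1 := by
    have := (Real.le_log_iff_exp_le hδ0).2 hδ1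
    rw [one_div, Real.log_inv]
    linarith
  have hm1 : 1 ≤ m := hm ▸ Nat.one_le_iff_ne_zero.2 (Nat.ceil_pos.2 hlog0).ne'
  have hmc : (m : ℝ) ≤ MoMReg.cConst d ρ σ * n := by
    have := Nat.ceil_lt_add_one hlog0.le
    rw [hm, MoMReg.numBlocks]
    linarith
  have hm0 : (0 : ℝ) < m := by exact_mod_cast hm1
  have hc1 : MoMReg.cConst d ρ σ ≤ 1 := min_le_right _ _
  have hmn : (m : ℝ) ≤ n :=
    hmc.trans (mul_le_of_le_one_left (Nat.cast_nonneg n) hc1)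
  have hn0 : (0 : ℝ) < n := hm0.trans_le hmn
  set t : ℝ := n / m with ht
  have ht1 : 1 ≤ t := (one_le_div hm0).2 hmn
  have ht0 : 0 < t := by positivity
  have hct : 1 ≤ MoMReg.cConst d ρ σ * t := by
    rw [ht, ← mul_div_assoc]
    exact (one_le_div hm0).2 hmc
  obtain ⟨K, hK⟩ : ∃ K : ℝ, K = (32 * Real.exp 1 ^ 2 * t / (ρ ^ (2 / (d : ℝ)) * σ ^ 2)) ^
    ((d : ℝ) / (d + 2)) := ⟨_, rfl⟩
  obtain ⟨s, hs⟩ : ∃ s : ℝ, s = (σ ^ 2 / (ρ * t)) ^ (1 / ((d : ℝ) + 2)) := ⟨_, rfl⟩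
  have hs0 : 0 < s := by rw [hs]; positivity
  obtain ⟨hK1, hKt⟩ := MoMReg.resampleSize_bounds hd hρ hσ ht0 hct
  obtain ⟨hKs, hKv⟩ := MoMReg.resampleSize_balance hd hρ hσ ht0 hK hs
  rw [← hK] at hK1 hKt
  have hkK : k = ⌊K⌋₊ := by
    rw [hk, MoMReg.kStar, hK]
    congr 2
    rw [ht]
    field_simp
  have hNt : N = ⌊t⌋₊ := by rw [hN, ht, Nat.floor_div_eq_div]
  have hk1 : 1 ≤ k := by rw [hkK]; exact (Nat.one_le_floor_iff _).2 hK1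
  have hkN : k ≤ N := by rw [hkK, hNt]; exact Nat.floor_mono hKt
  refine ⟨⟨hm1, hmc⟩, ⟨hk1, hkN⟩, fun block x hx => ?_⟩
  have hkle : (k : ℝ) ≤ K := by rw [hkK]; exact Nat.floor_le (by linarith)
  -- Rounding down a number at least `1` loses at most a factor `2`; hence the `1 / 2` in `hks` and
  -- the `64` in `hkv`.
  have hhalf : ∀ {a : ℝ}, 1 ≤ a → a / 2 ≤ (⌊a⌋₊ : ℝ) := by
    intro a ha
    have h1 := Nat.lt_floor_add_one a
    have h2 : (1 : ℝ) ≤ (⌊a⌋₊ : ℝ) := by exact_mod_cast (Nat.one_le_floor_iff _).2 ha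
    linarith
  have hkge : K / 2 ≤ k := by rw [hkK]; exact hhalf hK1
  have hNge : t / 2 ≤ N := by rw [hNt]; exact hhalf ht1
  have hks : 1 / 2 ≤ k * ρ * s ^ d := by
    have : K / 2 * ρ * s ^ d ≤ k * ρ * s ^ d := by gcongr
    linarith
  have hkv : σ ^ 2 * ((k : ℝ) / N) ≤ 64 * Real.exp 1 ^ 2 * s ^ 2 := by
    have h1 : (k : ℝ) / N ≤ K / (t / 2) := by gcongr
    have h2 := mul_le_mul_of_nonneg_left h1 (sq_nonneg σ)
    have h3 : σ ^ 2 * (K / (t / 2)) = 2 * (σ ^ 2 * (K / t)) := by field_simp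
    linarith
  set τ : Measure ℝ := volume.restrict (Set.Icc (0 : ℝ) 1) with hτ
  have : IsProbabilityMeasure τ := ⟨by simp [hτ]⟩
  set ε : ℝ := 128 * Real.exp 1 ^ 3 * s with hε
  have hε0 : 0 < ε := by positivity
  have hblock : (Measure.pi fun _ : Fin N => ν.prod τ) {z | ε ≤ |MoMReg.bagged k z x - r x|}
      ≤ ENNReal.ofReal (1 / (4 * Real.exp 1 ^ 2)) := by
    refine (hν.measure_bagged_le hd τ hk1 hkN hx hs0 hks hε0).trans (ENNReal.ofReal_le_ofReal ?_)
    -- The bias and noise terms each get half of the budget `1 / (4e²)`.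
    have h1 : 8 * s / (ε / 2) = 1 / (8 * Real.exp 1 ^ 3) := by
      rw [hε]
      field_simp
      norm_num
    have h2 : σ ^ 2 * ((k : ℝ) / N) / (ε / 2) ^ 2 ≤ 1 / (64 * Real.exp 1 ^ 4) := by
      rw [div_le_iff₀ (by positivity)]
      refine hkv.trans_eq ?_
      rw [hε]
      field_simp
      norm_num
    have h3 : 1 / (8 * Real.exp 1 ^ 3) ≤ 1 / (8 * Real.exp 1 ^ 2) :=
      one_div_le_one_div_of_le (by positivity)
        (mul_le_mul_of_nonneg_left (pow_le_pow_right₀ he1 (by norm_num)) (by norm_num))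
    have h4 : 1 / (64 * Real.exp 1 ^ 4) ≤ 1 / (8 * Real.exp 1 ^ 2) :=
      one_div_le_one_div_of_le (by positivity)
        (mul_le_mul (by norm_num) (pow_le_pow_right₀ he1 (by norm_num)) (by positivity)
          (by norm_num))
    have h5 : 1 / (8 * Real.exp 1 ^ 2) + 1 / (8 * Real.exp 1 ^ 2)
        = 1 / (4 * Real.exp 1 ^ 2) := by
      field_simp
      norm_num
    linarith
  have hεe : 128 * Real.exp 1 ^ 3 * (σ ^ 2 * (m : ℝ) / (ρ * n)) ^ (1 / ((d : ℝ) + 2)) = ε := by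
    rw [hε, hs, ht]
    congr 2
    field_simp
  obtain ⟨hbm, hbe⟩ := MoMReg.map_blocks_eq_pi hZ block
  have hmed := MoMReg.measure_le_abs_median_sub_le _ hm1 (MoMReg.measurable_bagged hk1 x) hblock
  rw [hεe]
  -- This inequality holds for every set, so measurability of the median is not needed.
  calc _ ≤ P.map (fun ω j i => Z (block (j, i)) ω)
        {z | ε ≤ |MoMReg.median (fun j => MoMReg.bagged k (z j) x) - r x|} :=
        Measure.le_map_apply hbm _
    _ ≤ ENNReal.ofReal (Real.exp (-m)) := by rw [hbe]; exact hmed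
    _ ≤ _ := by
        refine ENNReal.ofReal_le_ofReal ?_
        rw [← Real.le_log_iff_exp_le hδ0]
        have h := Nat.le_ceil (Real.log (1 / δ))
        have hlog : Real.log (1 / δ) = -Real.log δ := by rw [one_div, Real.log_inv]
        rw [hm, MoMReg.numBlocks]
        linarith
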